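/- **Conventions.** "Space" means compactly generated weak Hausdorff space. A *filtered space* is a space $X$ with a filtration $\emptyset=X^{-1}\subseteq X^0\subseteq\dots\subseteq X^n=X$ by closed subsets. Its *strata* are the non-empty path components of the sets $X^i\setminus X^{i-1}$. Such a stratum $S$ has $\dim S=i$ and $\operatorname{codim}S=n-i$. It is a *stratified space* if $S\cap\overline T\neq\emptyset$ implies $S\subseteq\overline T$ for all strata $S,T$. Write $S\preceq T$ if $S\subseteq\overline T$. The maximal strata are called *regular*, the others *singular*. A homotopy $Z\times[0,1]\to X$ is *stratum-preserving* if it maps each $\{z\}\times[0,1]$ into a single stratum. A map $f\colon X\to Y$ between stratified spaces is a *stratified fibration* if, for every space $Z$, every map $g\colon Z\to X$ and every stratum-preserving homotopy $H\colon Z\times[0,1]\to Y$ with $H(z,0)=f(g(z))$, there is a stratum-preserving homotopy $\widetilde H\colon Z\times[0,1]\to X$ with $f\widetilde H=H$ and $\widetilde H(z,0)=g(z)$. A *perversity* $\overline p$ on $X$ is a map from the set of strata to $\mathbb Z\cup\{\pm\infty\}$ with value $0$ on the regular strata. A simplex $\sigma\colon\Delta^\ell\to X$ is *$\overline p$-allowable*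 if, for each singular stratum $S$, the set $\sigma^{-1}(S)$ is contained in a polyhedron of dimension at most $\ell-\operatorname{codim}S+\overline p(S)$ (with $\dim\emptyset=-\infty$). It is *$\overline p$-full* if $\sigma$ and all its faces are $\overline p$-allowable. The $\overline p$-full simplexes form a simplicial subset $\mathscr G_{\overline p}X\subseteq\operatorname{Sing}X$. A subspace $F\subseteq X$ has the induced filtration $F^i=F\cap X^i$, of the same formal dimension $n$, and the induced perversity, again denoted $\overline p$: each stratum of $F$ lies in a unique stratum of $X$, from which it inherits the value of $\overline p$ and the quality of being regular or singular. This defines $\mathscr G_{\overline p}F\subseteq\operatorname{Sing}F$ by the same allowability condition on the strata of $F$. **Proposition.** Let $E$ and $B$ be stratified spaces such that $B$ has exactly one stratum, let $f\colon E\to B$ be a stratified fibration, and let $\overline p$ be a perversity on $E$. Let $\mathscr G_{\overline p}f\colon\mathscr G_{\overline p}E\to\operatorname{Sing}B$ be the map $\sigma\mapsto f\circ\sigma$. Then: 1. $\mathscr G_{\overline p}f$ is a Kan fibration. 2. Let $b\in B$ and $F=f^{-1}(b)$, and suppose that for each singular stratum $S$ of $E$ the family of strata of $F$ contained in $S$ is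 locally finite in $F$ (for instance, that $F$ has finitely many strata). Then the fibre $K$ of $\mathscr G_{\overline p}f$ over the vertex $b$ is homotopy equivalent to $\mathscr G_{\overline p}F$. More precisely, the inclusion $F\subseteq E$ induces a simplicial map $\mathscr G_{\overline p}F\to K$, and this map is a simplicial homotopy equivalence. -/

import Mathlib

open CategoryTheory Simplicial Opposite Topology

universe u

noncomputable section

namespace StratGajer

/-! ### Spaces, filtrations, strata -/

/-- The weak Hausdorff condition: every continuous image of a compact Hausdorff space is closed. -/
def IsWeakHausdorff (X : Type u) [TopologicalSpace X] : Prop :=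
  ∀ (K : Type u) [TopologicalSpace K] [CompactSpace K] [T2Space K] (g : K → X),
    Continuous g → IsClosed (Set.range g)

/-- Compactly generated weak Hausdorff spaces. -/
structure IsCGWH (X : Type u) [TopologicalSpace X] : Prop where
  compactlyGenerated : CompactlyGeneratedSpace X
  weakHausdorff : IsWeakHausdorff X

/-- A filtration `∅ = X⁻¹ ⊆ X⁰ ⊆ X¹ ⊆ ⋯ ⊆ Xⁿ = X` by closed subsets; `n` is `formalDim`. By
monotonicity `skel i = X` for all `i ≥ n`. -/
structure Filtration (X : Type u) [TopologicalSpace X] where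
  formalDim : ℕ
  skel : ℕ → Set X
  monotone_skel : Monotone skel
  isClosed_skel : ∀ i, IsClosed (skel i)
  skel_formalDim : skel formalDim = Set.univ

namespace Filtration

variable {X : Type u} [TopologicalSpace X] (Φ : Filtration X)

/-- The difference `X_i = Xⁱ \ Xⁱ⁻¹`. -/
def level (i : ℕ) : Set X := {x | x ∈ Φ.skel i ∧ ∀ j < i, x ∉ Φ.skel j}

/-- The strata are the (non-empty) path components of the differences `Xⁱ \ Xⁱ⁻¹`. -/
def Stratum : Type u :=
  {S : Set X // ∃ i, ∃ x ∈ Φ.level i, S = pathComponentIn (Φ.level i) x}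

/-- The underlying subset of a stratum. -/
def Stratum.carrier {Φ : Filtration X} (S : Φ.Stratum) : Set X := S.1

/-- The formal dimension of a stratum: the least `i` such that it is contained in `Xⁱ`. -/
def Stratum.dim {Φ : Filtration X} (S : Φ.Stratum) : ℕ := sInf {i | S.carrier ⊆ Φ.skel i}

/-- The formal codimension `n - dim S`. -/
def Stratum.codim {Φ : Filtration X} (S : Φ.Stratum) : ℤ := (Φ.formalDim : ℤ) - (S.dim : ℤ)

/-- The relation `S ≼ T`, that is `S ⊆ closure T`. -/
def Stratum.Prec {Φ : Filtration X} (S T : Φ.Stratum) : Prop := S.carrier ⊆ closure T.carrier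

/-- The regular strata are the maximal ones for `≼`. -/
def Stratum.IsRegular {Φ : Filtration X} (S : Φ.Stratum) : Prop :=
  ∀ T : Φ.Stratum, S.Prec T → T.Prec S

/-- The singular strata are the strata that are not regular. -/
def Stratum.IsSingular {Φ : Filtration X} (S : Φ.Stratum) : Prop := ¬ S.IsRegular

/-- A stratified space is a filtered space satisfying the frontier condition. -/
def IsStratified : Prop :=
  ∀ S T : Φ.Stratum, (S.carrier ∩ closure T.carrier).Nonempty → S.carrier ⊆ closure T.carrier

lemma exists_mem_level (x : X) : ∃ i, x ∈ Φ.level i := by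
  classical
  have h : ∃ i, x ∈ Φ.skel i := ⟨Φ.formalDim, by rw [Φ.skel_formalDim]; trivial⟩
  exact ⟨Nat.find h, Nat.find_spec h, fun j hj => Nat.find_min h hj⟩

lemma level_unique {x : X} {i j : ℕ} (hi : x ∈ Φ.level i) (hj : x ∈ Φ.level j) : i = j := by
  rcases lt_trichotomy i j with h | h | h
  · exact absurd hi.1 (hj.2 i h)
  · exact h
  · exact absurd hj.1 (hi.2 j h)

/-- The stratum that contains a given point. -/
def stratumAt (x : X) : Φ.Stratum :=
  ⟨pathComponentIn (Φ.level (Φ.exists_mem_level x).choose) x,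
    _, x, (Φ.exists_mem_level x).choose_spec, rfl⟩

lemma mem_stratumAt (x : X) : x ∈ (Φ.stratumAt x).carrier :=
  mem_pathComponentIn_self (Φ.exists_mem_level x).choose_spec

lemma Stratum.nonempty {Φ : Filtration X} (S : Φ.Stratum) : S.carrier.Nonempty := by
  obtain ⟨_, i, x, hx, rfl⟩ := S
  exact ⟨x, mem_pathComponentIn_self hx⟩

/-- Strata with a common point are equal. -/
lemma Stratum.eq_of_mem {Φ : Filtration X} {S T : Φ.Stratum} {x : X}
    (hS : x ∈ S.carrier) (hT : x ∈ T.carrier) : S = T := by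
  obtain ⟨_, i, y, hy, rfl⟩ := S
  obtain ⟨_, j, z, hz, rfl⟩ := T
  have h1 : x ∈ pathComponentIn (Φ.level i) y := hS
  have h2 : x ∈ pathComponentIn (Φ.level j) z := hT
  obtain rfl := Φ.level_unique (pathComponentIn_subset h1) (pathComponentIn_subset h2)
  apply Subtype.ext
  change pathComponentIn _ y = pathComponentIn _ z
  rw [← pathComponentIn_congr h1, pathComponentIn_congr h2]

/-- The induced filtration `Aⁱ = A ∩ Xⁱ` of a subspace `A`, of the same formal dimension. -/
def restrict (A : Set X) : Filtration A where
  formalDim := Φ.formalDim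
  skel i := Subtype.val ⁻¹' Φ.skel i
  monotone_skel _ _ h := Set.preimage_mono (Φ.monotone_skel h)
  isClosed_skel i := (Φ.isClosed_skel i).preimage continuous_subtype_val
  skel_formalDim := by rw [Φ.skel_formalDim, Set.preimage_univ]

/-- The stratum of `X` that contains a given stratum of the subspace `A`. -/
def ambient {A : Set X} (S : (Φ.restrict A).Stratum) : Φ.Stratum :=
  Φ.stratumAt (S.nonempty.some : X)

lemma subset_ambient {A : Set X} (S : (Φ.restrict A).Stratum) :
    Subtype.val '' S.carrier ⊆ (Φ.ambient S).carrier := by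
  have key : ∀ a ∈ S.carrier, ∀ b ∈ S.carrier, (b : X) ∈ (Φ.stratumAt (a : X)).carrier := by
    obtain ⟨_, i, y, hy, rfl⟩ := S
    intro a ha b hb
    have ha' : a ∈ pathComponentIn ((Φ.restrict A).level i) y := ha
    have hb' : b ∈ pathComponentIn ((Φ.restrict A).level i) y := hb
    rw [← pathComponentIn_congr ha'] at hb'
    obtain ⟨γ, hγ⟩ := hb'
    have hai : (a : X) ∈ Φ.level i := by
      have h := pathComponentIn_subset ha'
      exact h
    change (b : X) ∈ pathComponentIn (Φ.level _) (a : X)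
    rw [← Φ.level_unique hai (Φ.exists_mem_level (a : X)).choose_spec]
    exact ⟨γ.map continuous_subtype_val, fun t => hγ t⟩
  rintro _ ⟨b, hb, rfl⟩
  exact key _ S.nonempty.some_mem b hb

end Filtration

/-! ### Stratified fibrations -/

/-- A homotopy `Z × [0,1] → X` is stratum-preserving if each `{z} × [0,1]` is sent into a single
stratum of `X`. -/
def IsStratumPreserving {X Z : Type u} [TopologicalSpace X] (Φ : Filtration X)
    (H : Z × unitInterval → X) : Prop :=
  ∀ z, ∃ S : Φ.Stratum, ∀ t, H (z, t) ∈ S.carrier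

/-- Stratified fibrations: stratum-preserving homotopies (on arbitrary compactly generated weak
Hausdorff spaces) lift to stratum-preserving homotopies with prescribed initial map. -/
def IsStratifiedFibration {X Y : Type u} [TopologicalSpace X] [TopologicalSpace Y]
    (Φ : Filtration X) (Ψ : Filtration Y) (f : C(X, Y)) : Prop :=
  ∀ (Z : Type u) [TopologicalSpace Z], IsCGWH Z →
    ∀ (g : C(Z, X)) (H : C(Z × unitInterval, Y)), IsStratumPreserving Ψ H →
      (∀ z, H (z, 0) = f (g z)) →
      ∃ H' : C(Z × unitInterval, X), IsStratumPreserving Φ H' ∧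
        (∀ w, f (H' w) = H w) ∧ ∀ z, H' (z, 0) = g z

/-! ### Perversities -/

/-- The extended integers `ℤ ∪ {±∞}`. -/
abbrev ExtInt : Type := WithBot (WithTop ℤ)

/-- The inclusion of `ℤ` in the extended integers. -/
def ExtInt.ofInt (k : ℤ) : ExtInt := ((k : WithTop ℤ) : WithBot (WithTop ℤ))

/-- A perversity: a function from the strata to `ℤ ∪ {±∞}` with value `0` on the regular strata. -/
structure Perversity {X : Type u} [TopologicalSpace X] (Φ : Filtration X) where
  val : Φ.Stratum → ExtInt
  val_regular : ∀ S : Φ.Stratum, S.IsRegular → val S = 0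

/-! ### Polyhedral dimension -/

/-- A convex polyhedron: the intersection of finitely many closed half-spaces. -/
def IsConvexPolyhedron {V : Type*} [AddCommGroup V] [Module ℝ V] (P : Set V) : Prop :=
  ∃ I : Set ((V →ₗ[ℝ] ℝ) × ℝ), I.Finite ∧ P = {x | ∀ h ∈ I, h.1 x ≤ h.2}

/-- `A` is of polyhedral dimension at most `e`: it is contained in a polyhedron (a finite union of
convex polyhedra `P`) of dimension at most `e`, the dimension of `P` being that of its affine hull.
The family may be empty, so `dim ∅ = -∞`; for `e < 0` the condition says that `A` is empty.
For `A` in a simplex, intersecting the polyhedra with the simplex makes them compact. -/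
def HasPolyDimLE {V : Type*} [AddCommGroup V] [Module ℝ V] (A : Set V) (e : ExtInt) : Prop :=
  ∃ Q : Set (Set V), Q.Finite ∧ A ⊆ ⋃₀ Q ∧ ∀ P ∈ Q, IsConvexPolyhedron P ∧
    ExtInt.ofInt (Module.finrank ℝ (vectorSpan ℝ P) : ℤ) ≤ e

lemma HasPolyDimLE.preimage {V W : Type*} [AddCommGroup V] [Module ℝ V] [FiniteDimensional ℝ V]
    [AddCommGroup W] [Module ℝ W] [FiniteDimensional ℝ W] {A : Set W} {e e' : ExtInt}
    (hA : HasPolyDimLE A e) (L : V →ₗ[ℝ] W)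
    (he : ExtInt.ofInt (Module.finrank ℝ (LinearMap.ker L) : ℤ) + e ≤ e') :
    HasPolyDimLE (L ⁻¹' A) e' := by
  obtain ⟨Q, hQ, hAQ, hP⟩ := hA
  refine ⟨(fun P => L ⁻¹' P) '' Q, hQ.image _, ?_, ?_⟩
  · intro x hx
    obtain ⟨P, hPQ, hxP⟩ := hAQ hx
    exact ⟨L ⁻¹' P, ⟨P, hPQ, rfl⟩, hxP⟩
  · rintro _ ⟨P, hPQ, rfl⟩
    obtain ⟨⟨I, hI, rfl⟩, hdim⟩ := hP P hPQ
    refine ⟨⟨(fun h => (h.1 ∘ₗ L, h.2)) '' I, hI.image _, ?_⟩, ?_⟩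
    · ext x
      constructor
      · rintro hx _ ⟨h, hh, rfl⟩
        exact hx h hh
      · intro hx h hh
        exact hx _ ⟨h, hh, rfl⟩
    · set P : Set W := {x | ∀ h ∈ I, h.1 x ≤ h.2} with hPdef
      have h1 : vectorSpan ℝ (L ⁻¹' P) ≤ (vectorSpan ℝ P).comap L := by
        rw [vectorSpan_def, Submodule.span_le]
        rintro _ ⟨a, ha, b, hb, rfl⟩
        simp only [SetLike.mem_coe, Submodule.mem_comap, vsub_eq_sub, map_sub]
        exact vsub_mem_vectorSpan ℝ ha hb
      have h2 : Module.finrank ℝ ((vectorSpan ℝ P).comap L) ≤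
          Module.finrank ℝ (LinearMap.ker L) + Module.finrank ℝ (vectorSpan ℝ P) := by
        have h3 := LinearMap.finrank_range_add_finrank_ker
          (L.domRestrict ((vectorSpan ℝ P).comap L))
        have h4 : Module.finrank ℝ (LinearMap.range (L.domRestrict ((vectorSpan ℝ P).comap L))) ≤
            Module.finrank ℝ (vectorSpan ℝ P) := by
          apply Submodule.finrank_mono
          rintro _ ⟨⟨x, hx⟩, rfl⟩
          exact hx
        have h5 : Module.finrank ℝ (LinearMap.ker (L.domRestrict ((vectorSpan ℝ P).comap L))) ≤
            Module.finrank ℝ (LinearMap.ker L) := by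
          refine LinearMap.finrank_le_finrank_of_injective
            (f := LinearMap.codRestrict (LinearMap.ker L)
              (((vectorSpan ℝ P).comap L).subtype ∘ₗ Submodule.subtype _) ?_) ?_
          · rintro ⟨x, hx⟩
            exact hx
          · intro x y hxy
            apply Subtype.ext
            apply Subtype.ext
            have h8 := congrArg Subtype.val hxy
            exact h8
        omega
      have h6 := (Submodule.finrank_mono h1).trans h2
      refine le_trans ?_ (le_trans (add_le_add_right hdim _) he)
      have h7 : ((Module.finrank ℝ (vectorSpan ℝ (L ⁻¹' P)) : ℕ) : ℤ) ≤
          (Module.finrank ℝ (LinearMap.ker L) : ℤ) + (Module.finrank ℝ (vectorSpan ℝ P) : ℤ) := by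
        exact_mod_cast h6
      unfold ExtInt.ofInt
      exact_mod_cast h7

/-! ### The Gajer simplicial set -/

section Gajer

variable {X : Type u} [TopologicalSpace X] {Φ : Filtration X}

/-- The bound `n - codim S + p(S)` for the dimension of `σ⁻¹(S)`, `σ` an `n`-simplex. -/
def dimBound (p : Φ.Stratum → ExtInt) (n : ℕ) (S : Φ.Stratum) : ExtInt :=
  ExtInt.ofInt ((n : ℤ) - S.codim) + p S

/-- The simplex `σ` is allowable: `dim σ⁻¹(S) ≤ dim Δ - codim S + p(S)` for each stratum `S` in the
set `Sg` (of strata that are regarded as singular). -/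
def IsAllowable (Sg : Set Φ.Stratum) (p : Φ.Stratum → ExtInt) {n : ℕ}
    (σ : stdSimplex ℝ (Fin (n + 1)) → X) : Prop :=
  ∀ S ∈ Sg, HasPolyDimLE
    ((fun x : stdSimplex ℝ (Fin (n + 1)) => (x : Fin (n + 1) → ℝ)) '' (σ ⁻¹' S.carrier))
    (dimBound p n S)

/-- The continuous map `Δⁿ → X` that is a given simplex of the singular simplicial set. -/
def toMap {n : SimplexCategoryᵒᵖ} (σ : (TopCat.toSSet.obj (TopCat.of X)).obj n) :
    C(stdSimplex ℝ (Fin (n.unop.len + 1)), X) :=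
  TopCat.toSSetObjEquiv (TopCat.of X) n σ

lemma toMap_map {n m : SimplexCategoryᵒᵖ} (θ : n ⟶ m)
    (σ : (TopCat.toSSet.obj (TopCat.of X)).obj n) (x : stdSimplex ℝ (Fin (m.unop.len + 1))) :
    toMap ((TopCat.toSSet.obj (TopCat.of X)).map θ σ) x = toMap σ (stdSimplex.map θ.unop x) := rfl

/-- The simplex `σ` is full: `σ` and all its faces are allowable. (A face is the composite with
the map of simplices given by an injective monotone map.) -/
def IsFull (Sg : Set Φ.Stratum) (p : Φ.Stratum → ExtInt) {n : SimplexCategoryᵒᵖ}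
    (σ : (TopCat.toSSet.obj (TopCat.of X)).obj n) : Prop :=
  ∀ (m : SimplexCategory) (θ : m ⟶ n.unop), Mono θ →
    IsAllowable Sg p (toMap ((TopCat.toSSet.obj (TopCat.of X)).map θ.op σ))

lemma finrank_ker_linearMap {m k : ℕ} (s : Fin (m + 1) → Fin (k + 1)) (hs : Function.Surjective s) :
    Module.finrank ℝ (LinearMap.ker (FunOnFinite.linearMap ℝ ℝ s)) + k = m := by
  have hsurj : Function.Surjective (FunOnFinite.linearMap ℝ ℝ s) := by
    classical
    rw [← LinearMap.range_eq_top, eq_top_iff, ← (Pi.basisFun ℝ (Fin (k + 1))).span_eq,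
      Submodule.span_le]
    rintro _ ⟨i, rfl⟩
    obtain ⟨j, rfl⟩ := hs i
    refine ⟨Pi.single j 1, ?_⟩
    simp [FunOnFinite.linearMap_piSingle]
  have h := LinearMap.finrank_range_add_finrank_ker (FunOnFinite.linearMap ℝ ℝ s)
  rw [LinearMap.range_eq_top.2 hsurj] at h
  simp at h
  omega

lemma IsAllowable.degenerate {Sg : Set Φ.Stratum} {p : Φ.Stratum → ExtInt} {m k : ℕ}
    {σ : stdSimplex ℝ (Fin (k + 1)) → X} (hσ : IsAllowable Sg p σ)
    (s : Fin (m + 1) → Fin (k + 1)) (hs : Function.Surjective s) :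
    IsAllowable Sg p (fun x : stdSimplex ℝ (Fin (m + 1)) => σ (stdSimplex.map s x)) := by
  intro S hS
  have h := (hσ S hS).preimage (e' := dimBound p m S) (FunOnFinite.linearMap ℝ ℝ s) (by
    have hk := finrank_ker_linearMap s hs
    unfold dimBound
    rw [← add_assoc]
    refine add_le_add_left (le_of_eq ?_) _
    unfold ExtInt.ofInt
    have : (Module.finrank ℝ (LinearMap.ker (FunOnFinite.linearMap ℝ ℝ s)) : ℤ) +
        ((k : ℤ) - S.codim) = (m : ℤ) - S.codim := by omega
    rw [← this]
    rfl)
  obtain ⟨Q, hQ, hA, hP⟩ := h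
  refine ⟨Q, hQ, Set.Subset.trans ?_ hA, hP⟩
  rintro _ ⟨x, hx, rfl⟩
  exact ⟨stdSimplex.map s x, hx, rfl⟩

/-- The simplicial set of full simplexes, as a subcomplex of the singular simplicial set. -/
def gajer (Sg : Set Φ.Stratum) (p : Φ.Stratum → ExtInt) :
    (TopCat.toSSet.obj (TopCat.of X)).Subcomplex where
  obj n := {σ | IsFull Sg p σ}
  map {n k} g := by
    intro σ hσ m θ hθ
    let φ : m ⟶ n.unop := θ ≫ g.unop
    have hfac : Limits.factorThruImage φ ≫ Limits.image.ι φ = φ := Limits.image.fac φ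
    have h1 := hσ (Limits.image φ) (Limits.image.ι φ) inferInstance
    have hs : Function.Surjective (Limits.factorThruImage φ) :=
      SimplexCategory.epi_iff_surjective.1 inferInstance
    have h2 := h1.degenerate (Limits.factorThruImage φ) hs
    have h3 : (TopCat.toSSet.obj (TopCat.of X)).map θ.op
        ((TopCat.toSSet.obj (TopCat.of X)).map g σ) =
        (TopCat.toSSet.obj (TopCat.of X)).map (Limits.factorThruImage φ).op
          ((TopCat.toSSet.obj (TopCat.of X)).map (Limits.image.ι φ).op σ) := by
      have h4 : g ≫ θ.op = (Limits.image.ι φ).op ≫ (Limits.factorThruImage φ).op := by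
        rw [← op_comp, hfac]
        rfl
      have h5 := congrArg (fun a => (TopCat.toSSet.obj (TopCat.of X)).map a σ) h4
      simpa using h5
    rw [h3]
    exact h2

/-- The Gajer simplicial set of a perverse space. -/
def Perversity.gajer (p : Perversity Φ) : (TopCat.toSSet.obj (TopCat.of X)).Subcomplex :=
  StratGajer.gajer {S | S.IsSingular} p.val

/-- The Gajer simplicial set of a subspace `A` of a perverse space, with the induced filtration and
the induced perversity: a stratum of `A` has the value, and the singular or regular character, of the
stratum of `X` that contains it. -/
def Perversity.gajerOn (p : Perversity Φ) (A : Set X) :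
    (TopCat.toSSet.obj (TopCat.of A)).Subcomplex :=
  StratGajer.gajer (Φ := Φ.restrict A) {S | (Φ.ambient S).IsSingular} (fun S => p.val (Φ.ambient S))

/-- The simplicial map `𝒢_p E → Sing E → Sing B` induced by a continuous map `f : E → B`. -/
def Perversity.gajerMap (p : Perversity Φ) {B : Type u} [TopologicalSpace B] (f : C(X, B)) :
    (p.gajer : SSet.{u}) ⟶ TopCat.toSSet.obj (TopCat.of B) :=
  p.gajer.ι ≫ TopCat.toSSet.map (TopCat.ofHom f)

end Gajer

/-! ### Simplicial homotopy theory -/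

/-- Kan fibrations: maps with the right lifting property for the horn inclusions
`Λ[n + 1, i] ⟶ Δ[n + 1]`. -/
def IsKanFibration {X Y : SSet.{u}} (g : X ⟶ Y) : Prop :=
  SSet.modelCategoryQuillen.J.{u}.rlp g

/-- The fibre of a simplicial map over a vertex `y`. -/
def fibre {X Y : SSet.{u}} (g : X ⟶ Y) (y : Y _⦋0⦌) : X.Subcomplex :=
  (SSet.Subcomplex.ofSimplex y).preimage g

/-- Simplicial homotopy equivalences. -/
def IsSimplicialHomotopyEquiv {X Y : SSet.{u}} (φ : X ⟶ Y) : Prop :=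
  ∃ ψ : Y ⟶ X, Nonempty (SSet.Homotopy (φ ≫ ψ) (𝟙 X)) ∧ Nonempty (SSet.Homotopy (ψ ≫ φ) (𝟙 Y))

/-- The vertex of the singular simplicial set given by a point. -/
def vertex {B : Type u} [TopologicalSpace B] (b : B) : (TopCat.toSSet.obj (TopCat.of B)) _⦋0⦌ :=
  (TopCat.toSSetObjEquiv (TopCat.of B) (op ⦋0⦌)).symm (ContinuousMap.const _ b)

/-- The simplicial map `Sing A → Sing X` induced by the inclusion of a subspace. -/
def singIncl {X : Type u} [TopologicalSpace X] (A : Set X) :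
    TopCat.toSSet.obj (TopCat.of A) ⟶ TopCat.toSSet.obj (TopCat.of X) :=
  TopCat.toSSet.map (TopCat.ofHom ⟨Subtype.val, continuous_subtype_val⟩)

end StratGajer

end

/-! Horn filling. Let m(x) be the least coordinate of x ∈ Δⁿ⁺¹ with index ≠ i, and v = (n+1)eᵢ -
Σ_{k≠i} eₖ. Then x ↦ x + m(x)v retracts the simplex onto its i-th horn, and x + max(m(x) - t, 0)v
deforms it, from the retraction at t = 0 to x at t = m(x). A horn in E, extended to g on the simplex
by the retraction, is the initial map for lifting the deformed base simplex. That homotopy is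
stratum-preserving because B has one stratum. The filler evaluates the lift at (x, m(x)). On the
horn m = 0, so the given faces are kept.

Why the filler is full: the lift preserves strata, so the filler at x lies in the stratum of g(x).
Where xⱼ is the minimum, the retraction is a linear projection onto the j-th face with kernel ℝv.
Preimages of polyhedra hence gain at most one dimension, which is the gain of the bound from n to
n+1. On the face opposite to i the projection is injective, since v has nonzero i-th coordinate, and
nothing is gained. Every other face lies in the horn. See `exists_lift_of_hornExtension`,
`finrank_ker_hornProj_comp_add_le`, `isAllowable_hornFilling`.

Fibre. A simplex in F has compact image, so by local finiteness it meets only finitely many strata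
of F inside a given singular S. A finite union of polyhedra is a polyhedron, so allowability in F
and in E agree (`isAllowable_subspace_iff`), and the comparison map is even an isomorphism. -/

noncomputable section

namespace StratGajer

/-! ### Finite unions and polyhedral dimension -/

section PolyDim

variable {V : Type*} [AddCommGroup V] [Module ℝ V]

lemma HasPolyDimLE.mono_set {A A' : Set V} {e : ExtInt} (h : HasPolyDimLE A' e) (hA : A ⊆ A') :
    HasPolyDimLE A e := by
  obtain ⟨Q, hQ, hAQ, hP⟩ := h
  exact ⟨Q, hQ, hA.trans hAQ, hP⟩

lemma HasPolyDimLE.of_finite_cover {ι : Type*} {s : Set ι} (hs : s.Finite) {A : Set V}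
    {B : ι → Set V} {e : ExtInt} (hAB : A ⊆ ⋃ i ∈ s, B i)
    (hB : ∀ i ∈ s, HasPolyDimLE (B i) e) : HasPolyDimLE A e := by
  choose! Q hQ hBQ hP using hB
  refine ⟨⋃ i ∈ s, Q i, hs.biUnion hQ, fun x hx => ?_, fun P hPQ => ?_⟩
  · obtain ⟨i, hi, hxi⟩ := Set.mem_iUnion₂.1 (hAB hx)
    obtain ⟨P, hPi, hxP⟩ := hBQ i hi hxi
    exact ⟨P, Set.mem_iUnion₂.2 ⟨i, hi, hPi⟩, hxP⟩
  · obtain ⟨i, hi, hPi⟩ := Set.mem_iUnion₂.1 hPQ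
    exact hP i hi P hPi

end PolyDim

/-! ### Dimension and codimension of strata of a subspace -/

namespace Filtration

variable {X : Type u} [TopologicalSpace X] {Φ : Filtration X}

lemma Stratum.dim_eq {S : Φ.Stratum} {x : X} {i : ℕ} (hx : x ∈ S.carrier) (hi : x ∈ Φ.level i) :
    S.dim = i := by
  obtain ⟨_, j, y, hy, rfl⟩ := S
  have hx' : x ∈ pathComponentIn (Φ.level j) y := hx
  obtain rfl := Φ.level_unique hi (pathComponentIn_subset hx')
  have hmem : i ∈ {k | pathComponentIn (Φ.level i) y ⊆ Φ.skel k} :=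
    fun z hz => (pathComponentIn_subset hz).1
  apply le_antisymm (Nat.sInf_le hmem)
  by_contra h
  exact hi.2 _ (not_le.1 h) (Nat.sInf_mem ⟨i, hmem⟩ hx')

lemma ambient_eq_of_mem {A : Set X} {T : (Φ.restrict A).Stratum} {S : Φ.Stratum} {x : A}
    (hT : x ∈ T.carrier) (hS : (x : X) ∈ S.carrier) : Φ.ambient T = S :=
  Stratum.eq_of_mem (Φ.subset_ambient T ⟨x, hT, rfl⟩) hS

/-- The restricted filtration keeps the formal dimension of X, and a point has the same level in A
as in X. This makes the dimension bounds in A and in X coincide. -/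
lemma codim_ambient {A : Set X} (T : (Φ.restrict A).Stratum) :
    (Φ.ambient T).codim = T.codim := by
  obtain ⟨x, hx⟩ := T.nonempty
  obtain ⟨i, hi⟩ := Φ.exists_mem_level (x : X)
  have hi' : x ∈ (Φ.restrict A).level i := hi
  rw [Stratum.codim, Stratum.codim, Stratum.dim_eq hx hi',
    Stratum.dim_eq (Φ.subset_ambient T ⟨x, hx, rfl⟩) hi]
  rfl

end Filtration

/-! ### The Gajer simplicial set of a fibre -/

section Fibre

variable {X : Type u} [TopologicalSpace X] {Φ : Filtration X} (p : Perversity Φ) {A : Set X}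

lemma dimBound_ambient (n : ℕ) (T : (Φ.restrict A).Stratum) :
    dimBound (fun S => p.val (Φ.ambient S)) n T = dimBound p.val n (Φ.ambient T) := by
  rw [dimBound, dimBound, Filtration.codim_ambient]

/-- From X to A, each stratum of A lies in its ambient stratum. Conversely, the preimage of S is the
union of the preimages of the strata of A inside S, and compactness of the image leaves finitely
many of them non-empty. -/
lemma isAllowable_subspace_iff
    (hA : ∀ S : Φ.Stratum, S.IsSingular →
        LocallyFinite (fun T : {T : (Φ.restrict A).Stratum // Φ.ambient T = S} => T.1.carrier))
    {n : ℕ} {σ : stdSimplex ℝ (Fin (n + 1)) → A} (hσ : Continuous σ) :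
    IsAllowable (Φ := Φ) {S | S.IsSingular} p.val (fun x => (σ x : X)) ↔
      IsAllowable (Φ := Φ.restrict A) {S | (Φ.ambient S).IsSingular}
        (fun S => p.val (Φ.ambient S)) σ := by
  constructor
  · intro h T hT
    rw [dimBound_ambient]
    refine (h _ hT).mono_set (Set.image_mono fun x hx => ?_)
    exact Φ.subset_ambient T ⟨_, hx, rfl⟩
  · intro h S hS
    have hfin := (hA S hS).finite_nonempty_inter_compact (isCompact_range hσ)
    refine HasPolyDimLE.of_finite_cover hfin (B := fun T => Subtype.val '' (σ ⁻¹' T.1.carrier))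
      ?_ ?_
    · rintro _ ⟨x, hx, rfl⟩
      have hT := (Φ.restrict A).mem_stratumAt (σ x)
      exact Set.mem_iUnion₂.2 ⟨⟨_, Filtration.ambient_eq_of_mem hT hx⟩,
        ⟨σ x, hT, x, rfl⟩, x, hT, rfl⟩
    · rintro ⟨T, rfl⟩ -
      have := h T hS
      rwa [dimBound_ambient] at this

lemma isFull_singIncl_iff
    (hA : ∀ S : Φ.Stratum, S.IsSingular →
        LocallyFinite (fun T : {T : (Φ.restrict A).Stratum // Φ.ambient T = S} => T.1.carrier))
    {n : SimplexCategoryᵒᵖ} (σ : (TopCat.toSSet.obj (TopCat.of A)).obj n) :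
    (singIncl A).app n σ ∈ p.gajer.obj n ↔ σ ∈ (p.gajerOn A).obj n :=
  forall_congr' fun _ => forall_congr' fun θ => imp_congr_right fun _ =>
    isAllowable_subspace_iff p hA (toMap ((TopCat.toSSet.obj (TopCat.of A)).map θ.op σ)).continuous

lemma toMap_injective {n : SimplexCategoryᵒᵖ} :
    Function.Injective (toMap : (TopCat.toSSet.obj (TopCat.of X)).obj n → _) :=
  (TopCat.toSSetObjEquiv (TopCat.of X) n).injective

lemma singIncl_injective (n : SimplexCategoryᵒᵖ) :
    Function.Injective ((singIncl A).app n) := by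
  intro σ τ h
  apply toMap_injective
  ext x
  exact congrArg (fun ρ => toMap ρ x) h

variable {B : Type u} [TopologicalSpace B]

/-- The simplexes generated by a vertex are its degeneracies, which are the constant maps. -/
lemma mem_ofSimplex_vertex_iff {b : B} {n : SimplexCategoryᵒᵖ}
    (τ : (TopCat.toSSet.obj (TopCat.of B)).obj n) :
    τ ∈ (SSet.Subcomplex.ofSimplex (vertex b)).obj n ↔ ∀ x, toMap τ x = b := by
  rw [SSet.Subcomplex.mem_ofSimplex_obj_iff]
  constructor
  · rintro ⟨g, rfl⟩ x
    rfl
  · intro h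
    refine ⟨SimplexCategory.const _ _ 0, toMap_injective ?_⟩
    ext x
    exact (h x).symm

lemma mem_fibre_iff (f : C(X, B)) {b : B} {n : SimplexCategoryᵒᵖ}
    (σ : (p.gajer : SSet.{u}).obj n) :
    σ ∈ (fibre (p.gajerMap f) (vertex b)).obj n ↔ ∀ x, f (toMap σ.1 x) = b :=
  mem_ofSimplex_vertex_iff _

lemma isSimplicialHomotopyEquiv_of_isIso {Y Z : SSet.{u}} (φ : Y ⟶ Z) [IsIso φ] :
    IsSimplicialHomotopyEquiv φ :=
  ⟨inv φ, ⟨SSet.RelativeMorphism.Homotopy.ofEq (by simp)⟩,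
    ⟨SSet.RelativeMorphism.Homotopy.ofEq (by simp)⟩⟩

/-- The simplicial map from the Gajer simplicial set of the fibre of `f` over `b` to the fibre over
`b` of the map of Gajer simplicial sets induced by `f`. -/
def gajerOnToFibre (f : C(X, B)) (b : B)
    (hA : ∀ S : Φ.Stratum, S.IsSingular → LocallyFinite
      (fun T : {T : (Φ.restrict (f ⁻¹' {b})).Stratum // Φ.ambient T = S} => T.1.carrier)) :
    (p.gajerOn (f ⁻¹' {b}) : SSet.{u}) ⟶ (fibre (p.gajerMap f) (vertex b) : SSet.{u}) :=
  SSet.Subcomplex.lift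
    (SSet.Subcomplex.lift ((p.gajerOn (f ⁻¹' {b})).ι ≫ singIncl (f ⁻¹' {b})) (B := p.gajer) (by
      rintro n _ ⟨σ, rfl⟩
      exact (isFull_singIncl_iff p hA σ.1).2 σ.2))
    (by
      rintro n _ ⟨σ, rfl⟩
      rw [mem_fibre_iff]
      intro x
      exact (toMap σ.1 x).2)

/-- A simplex of E over b is a continuous map into the subspace over b, and its fullness may be
tested on either side. -/
lemma isIso_gajerOnToFibre (f : C(X, B)) (b : B)
    (hA : ∀ S : Φ.Stratum, S.IsSingular → LocallyFinite
      (fun T : {T : (Φ.restrict (f ⁻¹' {b})).Stratum // Φ.ambient T = S} => T.1.carrier)) :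
    IsIso (gajerOnToFibre p f b hA) := by
  rw [NatTrans.isIso_iff_isIso_app]
  intro n
  rw [isIso_iff_bijective]
  constructor
  · intro σ τ h
    apply Subtype.ext
    apply singIncl_injective n
    exact congrArg (fun ρ => ρ.1.1) h
  · rintro ⟨τ, hτ⟩
    have hb := (mem_fibre_iff p f τ).1 hτ
    let σ : (TopCat.toSSet.obj (TopCat.of (f ⁻¹' {b}))).obj n :=
      (TopCat.toSSetObjEquiv (TopCat.of (f ⁻¹' {b})) n).symm
        ⟨fun x => ⟨toMap τ.1 x, hb x⟩, by fun_prop⟩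
    have hσ : (singIncl (f ⁻¹' {b})).app n σ = τ.1 := by
      apply toMap_injective
      ext x
      rfl
    have hmem : σ ∈ (p.gajerOn (f ⁻¹' {b})).obj n := by
      rw [← isFull_singIncl_iff p hA, hσ]
      exact τ.2
    exact ⟨⟨σ, hmem⟩, Subtype.ext (Subtype.ext hσ)⟩

end Fibre

/-! ### The retraction of a simplex onto a horn -/

section HornRetraction

variable {n : ℕ} (i : Fin (n + 2))

/-- The direction of the projection of the simplex onto its `i`-th horn. -/
def hornVec : Fin (n + 2) → ℝ := fun k => if k = i then n + 1 else -1

lemma hornVec_self : hornVec i i = n + 1 := if_pos rfl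

lemma hornVec_of_ne {k : Fin (n + 2)} (hk : k ≠ i) : hornVec i k = -1 := if_neg hk

/-- Moving along `hornVec` preserves the sum of the coordinates. -/
lemma sum_hornVec : ∑ k, hornVec i k = 0 := by
  rw [Fin.sum_univ_succAbove _ i, hornVec_self,
    Finset.sum_congr rfl fun k _ => hornVec_of_ne i (Fin.succAbove_ne i k)]
  simp

lemma erase_univ_nonempty : (Finset.univ.erase i).Nonempty :=
  ⟨i.succAbove 0, by simp⟩

/-- The minimum of the coordinates of index different from `i`. -/
def hornMin (x : Fin (n + 2) → ℝ) : ℝ := (Finset.univ.erase i).inf' (erase_univ_nonempty i) x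

variable {i}

lemma hornMin_le (x : Fin (n + 2) → ℝ) {k : Fin (n + 2)} (hk : k ≠ i) : hornMin i x ≤ x k :=
  Finset.inf'_le _ (by simp [hk])

lemma exists_eq_hornMin (x : Fin (n + 2) → ℝ) : ∃ j, j ≠ i ∧ x j = hornMin i x := by
  obtain ⟨j, hj, h⟩ := Finset.exists_mem_eq_inf' (erase_univ_nonempty i) x
  exact ⟨j, by simpa using hj, h.symm⟩

lemma continuous_hornMin : Continuous (hornMin i) := by
  have h := Continuous.finset_inf' (erase_univ_nonempty i)
    (f := fun k (x : Fin (n + 2) → ℝ) => x k) fun k _ => continuous_apply k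
  convert h using 1
  ext x
  rw [Finset.inf'_apply]
  rfl

lemma hornMin_nonneg (x : stdSimplex ℝ (Fin (n + 2))) : 0 ≤ hornMin i x := by
  obtain ⟨j, -, h⟩ := exists_eq_hornMin (i := i) x
  rw [← h]
  exact stdSimplex.zero_le x j

lemma hornMin_le_one (x : stdSimplex ℝ (Fin (n + 2))) : hornMin i x ≤ 1 := by
  obtain ⟨j, -, h⟩ := exists_eq_hornMin (i := i) x
  rw [← h]
  exact stdSimplex.le_one x j

lemma hornMin_eq_zero (x : stdSimplex ℝ (Fin (n + 2))) {j : Fin (n + 2)} (hj : j ≠ i)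
    (hx : x j = 0) : hornMin i x = 0 :=
  le_antisymm ((hornMin_le _ hj).trans_eq hx) (hornMin_nonneg x)

lemma continuous_stdSimplex_coe {ι : Type*} [Fintype ι] :
    Continuous (fun x : stdSimplex ℝ ι => (x : ι → ℝ)) := continuous_subtype_val

variable (i) in
/-- The time at which the deformation `hornPush` reaches a given point. -/
def hornTime : C(stdSimplex ℝ (Fin (n + 2)), unitInterval) :=
  ⟨fun x => ⟨hornMin i x, hornMin_nonneg x, hornMin_le_one x⟩,
    (continuous_hornMin.comp continuous_stdSimplex_coe).subtype_mk _⟩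

variable (i) in
/-- The deformation from the retraction of a simplex onto its `i`-th horn to the identity. -/
def hornPush : C(stdSimplex ℝ (Fin (n + 2)) × unitInterval, stdSimplex ℝ (Fin (n + 2))) where
  toFun q := ⟨(q.1 : Fin (n + 2) → ℝ) + max (hornMin i q.1 - q.2) 0 • hornVec i, by
    obtain ⟨x, t⟩ := q
    have hmax : 0 ≤ max (hornMin i x - t) 0 := le_max_right _ _
    constructor
    · intro k
      rw [Pi.add_apply, Pi.smul_apply, smul_eq_mul]
      by_cases hk : k = i
      · subst hk
        rw [hornVec_self]
        have := stdSimplex.zero_le x k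
        positivity
      · rw [hornVec_of_ne i hk]
        -- Each coordinate other than the i-th decreases by at most the minimum of these
        -- coordinates, so none becomes negative.
        have h1 : max (hornMin i x - t) 0 ≤ x k :=
          max_le (by linarith [hornMin_le (i := i) x hk, t.2.1]) (stdSimplex.zero_le x k)
        linarith
    · simp only [Pi.add_apply, Pi.smul_apply, smul_eq_mul, Finset.sum_add_distrib,
        ← Finset.mul_sum, sum_hornVec, mul_zero, add_zero]
      exact stdSimplex.sum_eq_one x⟩
  continuous_toFun := by
    have h1 : Continuous fun q : stdSimplex ℝ (Fin (n + 2)) × unitInterval => hornMin i q.1 :=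
      continuous_hornMin.comp (continuous_stdSimplex_coe.comp continuous_fst)
    exact ((continuous_stdSimplex_coe.comp continuous_fst).add
      (((h1.sub (continuous_subtype_val.comp continuous_snd)).max continuous_const).smul
        continuous_const)).subtype_mk _

lemma coe_hornPush_zero (x : stdSimplex ℝ (Fin (n + 2))) :
    (hornPush i (x, 0) : Fin (n + 2) → ℝ) = (x : Fin (n + 2) → ℝ) + hornMin i x • hornVec i := by
  change (x : Fin (n + 2) → ℝ) + max (hornMin i x - ((0 : unitInterval) : ℝ)) 0 • hornVec i = _
  rw [Set.Icc.coe_zero, sub_zero, max_eq_left (hornMin_nonneg x)]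

/-- The stopping time depends on the point. It is 0 on the horn, so a lift evaluated at this time
keeps its initial values there. -/
lemma hornPush_hornTime (x : stdSimplex ℝ (Fin (n + 2))) : hornPush i (x, hornTime i x) = x := by
  apply stdSimplex.ext
  change (x : Fin (n + 2) → ℝ) + max (hornMin i x - hornMin i x) 0 • hornVec i = _
  simp

lemma hornPush_zero_apply (x : stdSimplex ℝ (Fin (n + 2))) {j : Fin (n + 2)} (hj : j ≠ i)
    (hx : x j = hornMin i x) : hornPush i (x, 0) j = 0 := by
  rw [coe_hornPush_zero, Pi.add_apply, Pi.smul_apply, hornVec_of_ne i hj, hx]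
  simp

lemma hornPush_zero_eq_self (x : stdSimplex ℝ (Fin (n + 2))) (hx : hornMin i x = 0) :
    hornPush i (x, 0) = x := by
  apply stdSimplex.ext
  rw [coe_hornPush_zero, hx, zero_smul, add_zero]

variable (i) in
/-- The projection along `hornVec i` onto the hyperplane of the `j`-th face, in the coordinates of
that face. -/
def hornProj (j : Fin (n + 2)) : (Fin (n + 2) → ℝ) →ₗ[ℝ] (Fin (n + 1) → ℝ) :=
  (LinearMap.funLeft ℝ ℝ j.succAbove) ∘ₗ
    (LinearMap.id + (LinearMap.proj j).smulRight (hornVec i))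

lemma hornProj_apply (j : Fin (n + 2)) (x : Fin (n + 2) → ℝ) (k : Fin (n + 1)) :
    hornProj i j x k = x (j.succAbove k) + x j * hornVec i (j.succAbove k) := rfl

/-- `hornProj i j` forgets the j-th coordinate of x + xⱼ • `hornVec i`, and that coordinate is 0
because `hornVec i` is -1 there. So the kernel consists of multiples of `hornVec i`. -/
lemma eq_of_hornProj_eq_zero {j : Fin (n + 2)} (hj : j ≠ i) {x : Fin (n + 2) → ℝ}
    (hx : hornProj i j x = 0) : x = (-x j) • hornVec i := by
  ext k
  rw [Pi.smul_apply, smul_eq_mul]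
  rcases Fin.eq_self_or_eq_succAbove j k with rfl | ⟨l, rfl⟩
  · rw [hornVec_of_ne i hj]
    ring
  · have := congrFun hx l
    rw [hornProj_apply, Pi.zero_apply] at this
    linarith

lemma finrank_ker_hornProj_le {j : Fin (n + 2)} (hj : j ≠ i) :
    Module.finrank ℝ (LinearMap.ker (hornProj i j)) ≤ 1 := by
  refine (Submodule.finrank_mono (t := ℝ ∙ hornVec i) fun x hx => ?_).trans
    (finrank_span_le_card _) |>.trans (by simp)
  exact Submodule.mem_span_singleton.2 ⟨_, (eq_of_hornProj_eq_zero hj hx).symm⟩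

lemma linearMap_injective {k m : ℕ} {θ : Fin k → Fin m} (hθ : Function.Injective θ) :
    Function.Injective (FunOnFinite.linearMap ℝ ℝ θ) := by
  classical
  intro x y h
  ext a
  have := congrFun h (θ a)
  simpa [FunOnFinite.linearMap_apply_apply, hθ.eq_iff, Finset.filter_eq'] using this

lemma linearMap_apply_of_notMem_range {k m : ℕ} {θ : Fin k → Fin m} {j : Fin m}
    (hj : ∀ a, θ a ≠ j) (x : Fin k → ℝ) : FunOnFinite.linearMap ℝ ℝ θ x j = 0 := by
  classical
  rw [FunOnFinite.linearMap_apply_apply]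
  exact Finset.sum_eq_zero fun a ha => absurd (by simpa using ha) (hj a)

/-- The dimension of the fibres of the projection `hornProj i j` on the simplex itself and on the
face opposite to the vertex `i`. -/
lemma finrank_ker_hornProj_comp_add_le {q : ℕ} {θ : Fin (q + 1) → Fin (n + 2)}
    (hθ : Function.Injective θ) (hr : ∀ k, k ≠ i → ∃ a, θ a = k) {j : Fin (n + 2)} (hj : j ≠ i) :
    Module.finrank ℝ (LinearMap.ker (hornProj i j ∘ₗ FunOnFinite.linearMap ℝ ℝ θ)) + n ≤ q := by
  classical
  set T := FunOnFinite.linearMap ℝ ℝ θ with hT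
  have hinj : Function.Injective T := linearMap_injective hθ
  -- If θ hits i it is bijective, so q = n + 1 and a kernel of dimension 1 is affordable. Otherwise
  -- θ is the face opposite to i, and the kernel must vanish.
  by_cases hi : ∃ a, θ a = i
  · have hsurj : Function.Surjective θ := fun k => by
      by_cases hk : k = i
      · exact hk ▸ hi
      · exact hr k hk
    have hcard := Fintype.card_of_bijective ⟨hθ, hsurj⟩
    simp only [Fintype.card_fin] at hcard
    have h1 : Module.finrank ℝ (LinearMap.ker (hornProj i j ∘ₗ T)) ≤
        Module.finrank ℝ (LinearMap.ker (hornProj i j)) := by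
      refine LinearMap.finrank_le_finrank_of_injective
        (f := T.restrict (p := LinearMap.ker (hornProj i j ∘ₗ T))
          (q := LinearMap.ker (hornProj i j)) fun x hx => hx) ?_
      intro x y h
      exact Subtype.ext (hinj (congrArg Subtype.val h))
    have h2 := finrank_ker_hornProj_le hj
    omega
  · push Not at hi
    have hle : n ≤ q := by
      have hsub : Finset.univ.erase i ⊆ Finset.univ.image θ := fun k hk => by
        simpa using hr k (by simpa using hk)
      have := (Finset.card_le_card hsub).trans Finset.card_image_le
      simp at this
      omega
    have hker : LinearMap.ker (hornProj i j ∘ₗ T) = ⊥ := by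
      rw [LinearMap.ker_eq_bot']
      intro x hx
      have h1 := eq_of_hornProj_eq_zero hj (x := T x) hx
      -- A multiple of `hornVec i` with i-th coordinate 0 is 0, as `hornVec i i` is n + 1.
      have h2 : T x i = 0 := linearMap_apply_of_notMem_range hi x
      have h3 := congrFun h1 i
      rw [h2, Pi.smul_apply, hornVec_self, smul_eq_mul] at h3
      have h4 : -T x j = 0 := by
        rcases mul_eq_zero.1 h3.symm with h | h
        · exact h
        · exact absurd h (by positivity)
      rw [h4, zero_smul] at h1
      exact hinj (h1.trans (map_zero T).symm)
    rw [hker, finrank_bot]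
    omega

end HornRetraction

/-! ### Gluing the faces of a horn -/

section HornGluing

/-- Vertices of weight 0 do not contribute. On the face where xⱼ = 0, this lets a degeneracy
followed by the j-th face act as the identity. -/
lemma stdSimplex_map_eq_of_eqOn {k m : ℕ} {θ ψ : Fin k → Fin m} (z : stdSimplex ℝ (Fin k))
    (h : ∀ a, z a ≠ 0 → θ a = ψ a) : stdSimplex.map θ z = stdSimplex.map ψ z := by
  classical
  ext b
  rw [stdSimplex.map_coe, stdSimplex.map_coe, FunOnFinite.linearMap_apply_apply,
    FunOnFinite.linearMap_apply_apply, Finset.sum_filter, Finset.sum_filter]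
  refine Finset.sum_congr rfl fun a _ => ?_
  by_cases ha : z a = 0
  · simp [ha]
  · rw [h a ha]

lemma stdSimplex_map_injective {k m : ℕ} {θ : Fin k → Fin m} (hθ : Function.Injective θ) :
    Function.Injective (stdSimplex.map (S := ℝ) θ) := fun _ _ h =>
  stdSimplex.ext (linearMap_injective hθ
    (congrArg (fun z : stdSimplex ℝ (Fin m) => (z : Fin m → ℝ)) h))

/-- Every point of a simplex lies in the interior of a face. -/
lemma exists_map_eq_support {N : ℕ} (z : stdSimplex ℝ (Fin (N + 1))) :
    ∃ (m : ℕ) (e : ⦋m⦌ ⟶ ⦋N⦌) (w : stdSimplex ℝ (Fin (m + 1))),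
      stdSimplex.map e w = z ∧ ∀ a, z (e a) ≠ 0 := by
  classical
  set s : Finset (Fin (N + 1)) := Finset.univ.filter fun a => z a ≠ 0 with hs
  have hsum : ∑ a ∈ s, z a = 1 := by
    rw [hs, Finset.sum_filter_ne_zero]
    exact stdSimplex.sum_eq_one z
  have hne : s.Nonempty := by
    rw [Finset.nonempty_iff_ne_empty]
    intro h
    simp [h] at hsum
  obtain ⟨m, hm⟩ := Nat.exists_eq_succ_of_ne_zero hne.card_pos.ne'
  set e := s.orderEmbOfFin hm with he
  have hes : ∀ a, e a ∈ s := fun a => s.orderEmbOfFin_mem hm a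
  have himg : Finset.univ.image e = s := by
    apply Finset.coe_injective
    rw [Finset.coe_image, Finset.coe_univ, Set.image_univ]
    exact s.range_orderEmbOfFin hm
  have hw : ∑ a, z (e a) = 1 := by
    rw [← hsum, ← himg, Finset.sum_image e.injective.injOn]
  refine ⟨m, SimplexCategory.mkHom e.toOrderHom,
    ⟨fun a => z (e a), fun a => stdSimplex.zero_le z _, hw⟩, ?_,
    fun a => (Finset.mem_filter.1 (hes a)).2⟩
  ext b
  rw [stdSimplex.map_coe, FunOnFinite.linearMap_apply_apply, Finset.sum_filter]
  change (∑ a, if e a = b then z (e a) else 0) = z b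
  by_cases hb : b ∈ s
  · rw [← himg, Finset.mem_image] at hb
    obtain ⟨a, -, rfl⟩ := hb
    simp [e.injective.eq_iff]
  · have hzb : z b = 0 := by simpa [hs] using hb
    rw [hzb]
    refine Finset.sum_eq_zero fun a _ => if_neg ?_
    rintro rfl
    exact hb (hes a)

variable {X : Type u} [TopologicalSpace X] {n : ℕ} {i : Fin (n + 2)}
  (γ : (Λ[n + 1, i] : SSet.{u}) ⟶ TopCat.toSSet.obj (TopCat.of X))

/-- The face of index `j` of a horn in the singular simplicial set. -/
def hornFace {j : Fin (n + 2)} (hj : j ≠ i) : C(stdSimplex ℝ (Fin (n + 1)), X) :=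
  toMap (γ.app _ (SSet.horn.face i j hj))

/-- A simplex of the horn that is given by a monotone map omitting some `j ≠ i`. -/
def hornSimplex {m : ℕ} (e : ⦋m⦌ ⟶ ⦋n + 1⦌) (he : ∃ j, j ≠ i ∧ ∀ a, e a ≠ j) :
    (Λ[n + 1, i] : SSet.{u}).obj (op ⦋m⦌) :=
  ⟨SSet.stdSimplex.objEquiv.symm e, (SSet.mem_horn_iff_notMem_range _ _).2 (by
    obtain ⟨j, hj, h⟩ := he
    exact ⟨j, hj, fun ⟨a, ha⟩ => h a ha⟩)⟩

lemma toMap_hornSimplex {m : ℕ} (e : ⦋m⦌ ⟶ ⦋n + 1⦌) (he : ∃ j, j ≠ i ∧ ∀ a, e a ≠ j)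
    {j : Fin (n + 2)} (hj : j ≠ i) (hej : ∀ a, e a ≠ j) (w : stdSimplex ℝ (Fin (m + 1))) :
    toMap (γ.app _ (hornSimplex e he)) w =
      hornFace γ hj (stdSimplex.map (SimplexCategory.factor_δ e j) w) := by
  have h1 : hornSimplex e he =
      (Λ[n + 1, i] : SSet.{u}).map (SimplexCategory.factor_δ e j).op (SSet.horn.face i j hj) := by
    apply Subtype.ext
    apply SSet.stdSimplex.objEquiv.injective
    exact (SimplexCategory.factor_δ_spec e j hej).symm
  rw [h1, NatTrans.naturality_apply]
  rfl

lemma factor_δ_δ {j : Fin (n + 2)} :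
    SimplexCategory.factor_δ (SimplexCategory.δ j) j = 𝟙 ⦋n⦌ := by
  rw [← cancel_mono (SimplexCategory.δ j), Category.id_comp]
  exact SimplexCategory.factor_δ_spec _ _ fun k => Fin.succAbove_ne j k

lemma map_factor_δ {m : ℕ} {e : ⦋m⦌ ⟶ ⦋n + 1⦌} {j : Fin (n + 2)} (hej : ∀ a, e a ≠ j)
    (w : stdSimplex ℝ (Fin (m + 1))) :
    stdSimplex.map j.succAbove (stdSimplex.map (SimplexCategory.factor_δ e j) w) =
      stdSimplex.map e w := by
  rw [stdSimplex.map_comp_apply]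
  have h := SimplexCategory.factor_δ_spec e j hej
  congr 1
  exact congrArg (fun g : ⦋m⦌ ⟶ ⦋n + 1⦌ => (g : Fin (m + 1) → Fin (n + 2))) h

/-- The common point is interior to a face e of the simplex. Its j-th and k-th coordinates vanish,
so e omits both indices. Both values are therefore that of the horn simplex e, by naturality of γ.
-/
lemma hornFace_compatible {j k : Fin (n + 2)} (hj : j ≠ i) (hk : k ≠ i)
    {y y' : stdSimplex ℝ (Fin (n + 1))}
    (h : stdSimplex.map j.succAbove y = stdSimplex.map k.succAbove y') :
    hornFace γ hj y = hornFace γ hk y' := by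
  obtain ⟨m, e, w, hw, he⟩ := exists_map_eq_support (stdSimplex.map j.succAbove y)
  have key : ∀ {l : Fin (n + 2)} (hl : l ≠ i) (u : stdSimplex ℝ (Fin (n + 1))),
      stdSimplex.map l.succAbove u = stdSimplex.map j.succAbove y →
      ∀ he' : ∃ j, j ≠ i ∧ ∀ a, e a ≠ j,
      toMap (γ.app _ (hornSimplex e he')) w = hornFace γ hl u := by
    intro l hl u hu he'
    have hel : ∀ a, e a ≠ l := fun a hal => he a (by
      rw [← hu, hal]
      exact linearMap_apply_of_notMem_range (Fin.succAbove_ne l) _)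
    rw [toMap_hornSimplex γ e he' hl hel]
    congr 1
    apply stdSimplex_map_injective (Fin.succAbove_right_injective (p := l))
    rw [map_factor_δ hel, hw, hu]
  have he' : ∃ j, j ≠ i ∧ ∀ a, e a ≠ j := ⟨j, hj, fun a hal => he a (by
    rw [hal]
    exact linearMap_apply_of_notMem_range (Fin.succAbove_ne j) _)⟩
  rw [← key hj y rfl he', ← key hk y' h.symm he']

/-- The coordinates in the `j`-th face of the retraction of a point onto the horn. -/
def hornCoord (j : Fin (n + 2)) : C(stdSimplex ℝ (Fin (n + 2)), stdSimplex ℝ (Fin (n + 1))) :=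
  -- This degeneracy is a left inverse of the j-th face map. It is defined on the whole simplex, but
  -- gives the coordinates of the retraction only where xⱼ is minimal.
  ⟨fun x => stdSimplex.map (SimplexCategory.σ (Fin.predAbove 0 j)) (hornPush i (x, 0)),
    (stdSimplex.continuous_map _).comp (by fun_prop)⟩

lemma map_hornCoord {j : Fin (n + 2)} (hj : j ≠ i) {x : stdSimplex ℝ (Fin (n + 2))}
    (hx : x j = hornMin i x) :
    stdSimplex.map j.succAbove (hornCoord (i := i) j x) = hornPush i (x, 0) := by
  change stdSimplex.map j.succAbove (stdSimplex.map _ _) = _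
  rw [stdSimplex.map_comp_apply]
  refine (stdSimplex_map_eq_of_eqOn (ψ := id) _ fun a ha => ?_).trans
    (stdSimplex.map_id_apply _)
  have haj : a ≠ j := by
    rintro rfl
    exact ha (hornPush_zero_apply x hj hx)
  obtain ⟨b, rfl⟩ := Fin.exists_succAbove_eq haj
  have := congrArg (fun g : ⦋n⦌ ⟶ ⦋n⦌ => g b) (factor_δ_δ (j := j))
  exact congrArg j.succAbove this

/-- Where xⱼ is the minimum the retraction is linear, so preimages of polyhedra are polyhedra. -/
lemma coe_hornCoord {j : Fin (n + 2)} (hj : j ≠ i) {x : stdSimplex ℝ (Fin (n + 2))}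
    (hx : x j = hornMin i x) :
    (hornCoord (i := i) j x : Fin (n + 1) → ℝ) = hornProj i j x := by
  classical
  ext k
  have h := congrArg (fun z : stdSimplex ℝ (Fin (n + 2)) => z (j.succAbove k)) (map_hornCoord hj hx)
  simp only [stdSimplex.map_coe, coe_hornPush_zero] at h
  rw [FunOnFinite.linearMap_apply_apply] at h
  simp only [Fin.succAbove_right_inj, Finset.filter_eq', Finset.mem_univ, if_true,
    Finset.sum_singleton] at h
  rw [h, hornProj_apply, Pi.add_apply, Pi.smul_apply, smul_eq_mul, hx]

/-- A horn in the singular simplicial set, extended to the simplex by the retraction. -/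
lemma exists_hornExtension :
    ∃ g : C(stdSimplex ℝ (Fin (n + 2)), X), ∀ (j : Fin (n + 2)) (hj : j ≠ i)
      (x : stdSimplex ℝ (Fin (n + 2))), x j = hornMin i x →
      g x = hornFace γ hj (hornCoord (i := i) j x) := by
  classical
  -- Any minimizing index may be chosen: two of them give the same retracted point, hence the same
  -- value by `hornFace_compatible`.
  choose J hJ hJx using fun x : stdSimplex ℝ (Fin (n + 2)) => exists_eq_hornMin (i := i) x
  let g : stdSimplex ℝ (Fin (n + 2)) → X := fun x => hornFace γ (hJ x) (hornCoord (i := i) (J x) x)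
  have hg : ∀ (j : Fin (n + 2)) (hj : j ≠ i) (x : stdSimplex ℝ (Fin (n + 2))),
      x j = hornMin i x → g x = hornFace γ hj (hornCoord (i := i) j x) := fun j hj x hx =>
    hornFace_compatible γ _ hj (by rw [map_hornCoord hj hx, map_hornCoord (hJ x) (hJx x)])
  refine ⟨⟨g, ?_⟩, hg⟩
  -- Continuity is checked on the finitely many closed regions where a fixed coordinate is minimal.
  refine (locallyFinite_of_finite
    fun j : {j : Fin (n + 2) // j ≠ i} =>
      Set.ofPred fun x : stdSimplex ℝ (Fin (n + 2)) => x j.1 = hornMin i x).continuous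
    ?_ ?_ ?_
  · exact Set.eq_univ_of_forall fun x => Set.mem_iUnion.2 ⟨⟨J x, hJ x⟩, hJx x⟩
  · intro j
    exact isClosed_eq ((continuous_apply j.1).comp continuous_stdSimplex_coe)
      (continuous_hornMin.comp continuous_stdSimplex_coe)
  · intro j
    refine ContinuousOn.congr (f := fun x => hornFace γ j.2 (hornCoord (i := i) j.1 x)) ?_
      fun x hx => hg j.1 j.2 x hx
    exact ((hornFace γ j.2).comp (hornCoord (i := i) j.1)).continuous.continuousOn

end HornGluing

/-! ### Lifting -/

section Lifting

lemma isCGWH_of_compact_t2 (Z : Type u) [TopologicalSpace Z] [CompactSpace Z] [T2Space Z] :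
    IsCGWH Z where
  compactlyGenerated := inferInstance
  weakHausdorff _ _ _ _ _ hg := (isCompact_range hg).isClosed

lemma isStratumPreserving_of_unique {B Z : Type u} [TopologicalSpace B] {Ψ : Filtration B}
    (hone : ∃ S : Ψ.Stratum, ∀ T : Ψ.Stratum, T = S) (H : Z × unitInterval → B) :
    IsStratumPreserving Ψ H := by
  obtain ⟨S, hS⟩ := hone
  exact fun z => ⟨S, fun t => hS (Ψ.stratumAt (H (z, t))) ▸ Ψ.mem_stratumAt _⟩

variable {E B : Type u} [TopologicalSpace E] [TopologicalSpace B] {Φ : Filtration E}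
  {Ψ : Filtration B} {f : C(E, B)}

/-- A lift of a simplex of the base along a horn, in which every point has the same stratum as its
image under the retraction onto the horn. -/
lemma exists_lift_of_hornExtension (hone : ∃ S : Ψ.Stratum, ∀ T : Ψ.Stratum, T = S)
    (hf : IsStratifiedFibration Φ Ψ f) {n : ℕ} {i : Fin (n + 2)}
    (g : C(stdSimplex ℝ (Fin (n + 2)), E)) (β : C(stdSimplex ℝ (Fin (n + 2)), B))
    (h : ∀ x : stdSimplex ℝ (Fin (n + 2)), β (hornPush i (x, 0)) = f (g x)) :
    ∃ σ : C(stdSimplex ℝ (Fin (n + 2)), E), (∀ x, f (σ x) = β x) ∧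
      (∀ x : stdSimplex ℝ (Fin (n + 2)), hornMin i x = 0 → σ x = g x) ∧
      ∀ (x) (S : Φ.Stratum), σ x ∈ S.carrier → g x ∈ S.carrier := by
  -- The simplex is lifted to the universe in which the fibration is tested.
  let H : C(ULift.{u} (stdSimplex ℝ (Fin (n + 2))) × unitInterval, B) :=
    ⟨fun q => β (hornPush i (q.1.down, q.2)), by fun_prop⟩
  obtain ⟨H', hH', hlift, hinit⟩ := hf _ (isCGWH_of_compact_t2 _)
    ⟨fun z => g z.down, by fun_prop⟩ H (isStratumPreserving_of_unique hone H) fun z => h z.down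
  refine ⟨⟨fun x => H' (⟨x⟩, hornTime i x), by fun_prop⟩, fun x => ?_, fun x hx => ?_,
    fun x S hS => ?_⟩
  · refine (hlift _).trans ?_
    change β (hornPush i (x, hornTime i x)) = β x
    rw [hornPush_hornTime]
  · have h0 : hornTime i x = 0 := Subtype.ext hx
    change H' (⟨x⟩, hornTime i x) = g x
    rw [h0]
    exact hinit ⟨x⟩
  -- The path t ↦ H'(x, t) stays in one stratum and joins g x to the value at the stopping time.
  · obtain ⟨T, hT⟩ := hH' ⟨x⟩
    obtain rfl := Filtration.Stratum.eq_of_mem hS (hT (hornTime i x))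
    have := hT 0
    rwa [hinit] at this

/-- The allowability of the filling of a horn, on the simplex and on the face opposite to `i`. -/
lemma isAllowable_hornFilling {n : ℕ} {i : Fin (n + 2)} {Sg : Set Φ.Stratum}
    {p : Φ.Stratum → ExtInt} {γ : (Λ[n + 1, i] : SSet.{u}) ⟶ TopCat.toSSet.obj (TopCat.of E)}
    (hγ : ∀ (j : Fin (n + 2)) (hj : j ≠ i), IsAllowable Sg p (hornFace γ hj))
    {g : stdSimplex ℝ (Fin (n + 2)) → E}
    (hg : ∀ (j : Fin (n + 2)) (hj : j ≠ i) (x : stdSimplex ℝ (Fin (n + 2))),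
      x j = hornMin i x → g x = hornFace γ hj (hornCoord (i := i) j x))
    {σ : stdSimplex ℝ (Fin (n + 2)) → E}
    (hσ : ∀ (x) (S : Φ.Stratum), σ x ∈ S.carrier → g x ∈ S.carrier)
    {q : ℕ} {θ : Fin (q + 1) → Fin (n + 2)} (hθ : Function.Injective θ)
    (hr : ∀ k, k ≠ i → ∃ a, θ a = k) :
    IsAllowable Sg p (fun w : stdSimplex ℝ (Fin (q + 1)) => σ (stdSimplex.map θ w)) := by
  intro S hS
  refine HasPolyDimLE.of_finite_cover (Set.finite_univ (α := {j : Fin (n + 2) // j ≠ i}))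
    (B := fun j => (hornProj i j.1 ∘ₗ FunOnFinite.linearMap ℝ ℝ θ) ⁻¹'
      ((fun y : stdSimplex ℝ (Fin (n + 1)) => (y : Fin (n + 1) → ℝ)) ''
        (hornFace γ j.2 ⁻¹' S.carrier))) ?_ ?_
  · rintro _ ⟨w, hw, rfl⟩
    obtain ⟨j, hj, hjx⟩ := exists_eq_hornMin (i := i) (stdSimplex.map θ w)
    refine Set.mem_iUnion₂.2 ⟨⟨j, hj⟩, Set.mem_univ _,
      hornCoord (i := i) j (stdSimplex.map θ w), ?_, coe_hornCoord hj hjx⟩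
    have := hσ _ S hw
    rwa [hg j hj _ hjx] at this
  · rintro ⟨j, hj⟩ -
    refine (hγ j hj S hS).preimage _ ?_
    -- The dimension of the kernel is at most q - n, exactly the difference between the bounds for a
    -- q-simplex and an n-simplex.
    have hk := finrank_ker_hornProj_comp_add_le hθ hr hj
    unfold dimBound
    rw [← add_assoc]
    refine add_le_add_left ?_ _
    unfold ExtInt.ofInt
    have : (Module.finrank ℝ (LinearMap.ker (hornProj i j ∘ₗ FunOnFinite.linearMap ℝ ℝ θ)) : ℤ) +
        ((n : ℤ) - S.codim) ≤ (q : ℤ) - S.codim := by omega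
    exact_mod_cast this

theorem isKanFibration_gajerMap (hone : ∃ S : Ψ.Stratum, ∀ T : Ψ.Stratum, T = S)
    (hf : IsStratifiedFibration Φ Ψ f) (p : Perversity Φ) : IsKanFibration (p.gajerMap f) := by
  intro _ _ ι hι
  simp only [SSet.modelCategoryQuillen.J, MorphismProperty.iSup_iff] at hι
  obtain ⟨n, ⟨i⟩⟩ := hι
  constructor
  intro α b sq
  let γ : (Λ[n + 1, i] : SSet.{u}) ⟶ TopCat.toSSet.obj (TopCat.of E) := α ≫ p.gajer.ι
  have hfull : ∀ (m : SimplexCategoryᵒᵖ) (s : (Λ[n + 1, i] : SSet.{u}).obj m),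
      IsFull {S | S.IsSingular} p.val (γ.app m s) := fun m s => (α.app m s).2
  let β : C(stdSimplex ℝ (Fin (n + 2)), B) := toMap (SSet.yonedaEquiv b)
  obtain ⟨g, hg⟩ := exists_hornExtension γ
  have hβ : ∀ (j : Fin (n + 2)) (hj : j ≠ i) (y : stdSimplex ℝ (Fin (n + 1))),
      β (stdSimplex.map j.succAbove y) = f (hornFace γ hj y) := by
    intro j hj y
    have h1 := congrArg (fun φ => toMap (φ.app _ (SSet.horn.face i j hj)) y) sq.w
    refine Eq.trans ?_ h1.symm
    have h2 : b.app _ (SSet.horn.face.{u} i j hj).1 =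
        (TopCat.toSSet.obj (TopCat.of B)).map (SimplexCategory.δ j).op (SSet.yonedaEquiv b) := by
      rw [SSet.yonedaEquiv_naturality]
      rfl
    change _ = toMap (b.app _ (SSet.horn.face.{u} i j hj).1) y
    rw [h2]
    rfl
  obtain ⟨σ, hσβ, hσg, hσS⟩ := exists_lift_of_hornExtension (i := i) hone hf g β fun x => by
    obtain ⟨j, hj, hjx⟩ := exists_eq_hornMin (i := i) x
    rw [hg j hj x hjx, ← hβ, map_hornCoord hj hjx]
  -- On the j-th face `hornMin` is 0, so the retraction fixes its points and the filler equals g.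
  have hσface : ∀ (j : Fin (n + 2)) (hj : j ≠ i) (y : stdSimplex ℝ (Fin (n + 1))),
      σ (stdSimplex.map j.succAbove y) = hornFace γ hj y := by
    intro j hj y
    have h0 : stdSimplex.map j.succAbove y j = 0 :=
      linearMap_apply_of_notMem_range (Fin.succAbove_ne j) _
    have hmin := hornMin_eq_zero _ hj h0
    have hj0 := h0.trans hmin.symm
    rw [hσg _ hmin, hg j hj _ hj0]
    congr 1
    apply stdSimplex_map_injective (Fin.succAbove_right_injective (p := j))
    rw [map_hornCoord hj hj0, hornPush_zero_eq_self _ hmin]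
  let s : (TopCat.toSSet.obj (TopCat.of E)).obj (op ⦋n + 1⦌) :=
    (TopCat.toSSetObjEquiv (TopCat.of E) (op ⦋n + 1⦌)).symm σ
  have hs : s ∈ p.gajer.obj (op ⦋n + 1⦌) := by
    intro m θ hθ
    induction m using SimplexCategory.rec with | _ q
    -- A face containing all vertices other than i is the whole simplex or the face opposite to i.
    -- Any other face lies in the horn, where allowability is given.
    by_cases hr : ∀ k, k ≠ i → ∃ a, θ a = k
    · have hallow : ∀ (j : Fin (n + 2)) (hj : j ≠ i),
          IsAllowable {S | S.IsSingular} p.val (hornFace γ hj) := fun j hj => by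
        have := hfull _ (SSet.horn.face i j hj) _ (𝟙 _) inferInstance
        rwa [op_id, Functor.map_id_apply] at this
      exact isAllowable_hornFilling hallow hg hσS (SimplexCategory.mono_iff_injective.1 hθ) hr
    · push Not at hr
      obtain ⟨j, hj, hθj⟩ := hr
      have h1 := hfull _ (hornSimplex θ ⟨j, hj, hθj⟩) _ (𝟙 _) inferInstance
      have h2 : (toMap ((TopCat.toSSet.obj (TopCat.of E)).map θ.op s) :
          stdSimplex ℝ (Fin (q + 1)) → E) =
          toMap (γ.app _ (hornSimplex θ ⟨j, hj, hθj⟩)) := by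
        ext w
        rw [toMap_hornSimplex γ θ _ hj hθj, ← hσface, map_factor_δ hθj]
        rfl
      rw [op_id, Functor.map_id_apply] at h1
      exact (congrArg (IsAllowable {S | S.IsSingular} p.val) h2).mpr h1
  refine ⟨⟨SSet.yonedaEquiv.symm ⟨s, hs⟩, ?_, ?_⟩⟩
  · apply SSet.horn.hom_ext
    intro j hj
    apply Subtype.ext
    apply toMap_injective
    ext y
    exact hσface j hj y
  · apply SSet.yonedaEquiv.injective
    refine (congrArg SSet.yonedaEquiv (SSet.yonedaEquiv_symm_comp _ _)).trans ?_
    refine (Equiv.apply_symm_apply _ _).trans ?_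
    apply toMap_injective
    ext x
    exact hσβ x

end Lifting

end StratGajer

end

open StratGajer in
theorem mainTheorem3 {E B : Type u} [TopologicalSpace E] [TopologicalSpace B]
    (hE : IsCGWH E) (hB : IsCGWH B) (Φ : Filtration E) (Ψ : Filtration B)
    (hΦ : Φ.IsStratified) (hΨ : Ψ.IsStratified)
    (hone : ∃ S : Ψ.Stratum, ∀ T : Ψ.Stratum, T = S)
    (f : C(E, B)) (hf : IsStratifiedFibration Φ Ψ f) (p : Perversity Φ) :
    IsKanFibration (p.gajerMap f) ∧
    ∀ b : B,
      (∀ S : Φ.Stratum, S.IsSingular →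
        LocallyFinite (fun T : {T : (Φ.restrict (f ⁻¹' {b})).Stratum // Φ.ambient T = S} =>
          T.1.carrier)) →
      ∃ φ : (p.gajerOn (f ⁻¹' {b}) : SSet.{u}) ⟶ (fibre (p.gajerMap f) (vertex b) : SSet.{u}),
        φ ≫ (fibre (p.gajerMap f) (vertex b)).ι ≫ p.gajer.ι =
          (p.gajerOn (f ⁻¹' {b})).ι ≫ singIncl (f ⁻¹' {b}) ∧
        IsSimplicialHomotopyEquiv φ := by
  refine ⟨isKanFibration_gajerMap hone hf p, fun b hb => ⟨gajerOnToFibre p f b hb, rfl, ?_⟩⟩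
  have := isIso_gajerOnToFibre p f b hb
  exact isSimplicialHomotopyEquiv_of_isIso _
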